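/- \textbf{Model.} A \emph{fully-parallel circuit} with $n$ inputs and $k$ output bits, in the Thompson model, is laid out on the planar grid of unit squares. Each computational node occupies one square. Each wire joins two nodes and runs through a path of squares, successive squares sharing a side, that contains no other node; two wires may meet in a square, but they never pass through the same side of a square. The computation takes $T\ge 1$ clock cycles, and in each cycle every wire carries one bit in each of its two directions. Nodes are deterministic and have memory: the bits a node sends depend only on its state, and its next state depends only on its state and the bits it receives. The $n$ inputs are loaded into $n$ distinct input nodes at the start, and the $k$ output bits are read from $k$ distinct output nodes at the end (a node may be both an input and an output node). The area $A$ is the number of squares occupied by nodes and wires, and the energy is $E=AT$. Fix $\varepsilon\in(0,1)$. A \emph{decoding scheme} is a sequence of such circuits (decoders) with block lengths $n_1<n_2<\cdots$ and numbers of decoded bits $k(n_1),k(n_2),\dots$, together with encoding functions $\{0,1\}^{k(n)}\to\{0,1\}^{n}$. The $k(n)$ source bits are independent fair coin flips, they are encoded, and the codeword is sent over $n$ uses of the binary erasure channel with erasure probability $\varepsilon$; the $n$ received symbols, each a bit or an erasure, are the inputs of the decoder. $P_{\mathrm e}(n)$ is the probability that the output of the decoder differs from the source. The scheme is \emph{exponentially-low-error}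 if, for some $c>0$, $P_{\mathrm e}(n)<e^{-cn}$ for all sufficiently large $n$ (among the block lengths), and $\lim_{n\to\infty}k(n)/n$ exists and is positive. \textbf{Statement.} Let $E(n)=A(n)T(n)$ and $T(n)$ be the energy and the number of clock cycles of the decoder of block length $n$ in an exponentially-low-error decoding scheme. \begin{enumerate} \item For every function $p$ with $p(n)\to\infty$ as $n\to\infty$ (in particular for every unbounded increasing function), $E(n)=\Omega\!\left(n^{3/2}/p(n)\right)$; that is, there is $C>0$ with $E(n)\ge C\,n^{3/2}/p(n)$ for all sufficiently large block lengths $n$. \item If $E(n)=O(n^{3/2})$, then $T(n)=\Omega(n^{1/2})$. \end{enumerate} -/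

import Mathlib

open Filter Topology

namespace Thompson

/-- The planar grid of unit squares, a square being named by its two integer coordinates.
Two squares are adjacent when they have a side in common. -/
def squareGrid : SimpleGraph (ℤ × ℤ) where
  Adj a b := |a.1 - b.1| + |a.2 - b.2| = 1
  symm := ⟨by
    intro a b h
    rw [abs_sub_comm b.1 a.1, abs_sub_comm b.2 a.2]
    exact h⟩
  loopless := ⟨by intro a h; simp at h⟩

/-- An output letter of the binary erasure channel: `some b` is the bit `b`, and `none` is
the erasure symbol. -/
abbrev Symbol : Type := Option Bool

/-- A fully-parallel circuit in the Thompson model, with `n` inputs (letters received from a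
binary erasure channel) and `k` output bits.

Layout: computational nodes occupy one square each; wires join two nodes and are routed
through squares that hold no other node. Two wires may meet in a square (a wire crossing),
but do not pass through the same side of a square.

Operation: the computation takes `cycles` clock cycles, and during a clock cycle each wire
carries one bit in each of its two directions. Nodes compute deterministically and have
memory; the next state of a node and the bits it sends depend only on its own state and on
the bits it receives. The `n` inputs are loaded into `n` distinct input nodes before the first
cycle, and the `k` output bits are read from `k` distinct output nodes after the last one.
A node may be both an input node and an output node. -/
structure Circuit (n k : ℕ) where
  /-- computational nodes -/
  Node : Type
  /-- wires -/
  Wire : Type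
  [fintypeNode : Fintype Node]
  [fintypeWire : Fintype Wire]
  /-- the square occupied by a node -/
  pos : Node → ℤ × ℤ
  pos_injective : Function.Injective pos
  /-- the two nodes joined by a wire -/
  ends : Wire → Bool → Node
  ends_ne : ∀ w, ends w false ≠ ends w true
  /-- the squares that a wire passes through, from one of its ends to the other -/
  route : ∀ w, squareGrid.Walk (pos (ends w false)) (pos (ends w true))
  route_isPath : ∀ w, (route w).IsPath
  route_avoids : ∀ w v, pos v ∈ (route w).support → ∃ b, ends w b = v
  route_disjoint : ∀ w w', w ≠ w' → (route w).edges.Disjoint (route w').edges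
  /-- the nodes into which the inputs are loaded -/
  inputNode : Fin n → Node
  inputNode_injective : Function.Injective inputNode
  /-- the nodes at which the outputs appear -/
  outputNode : Fin k → Node
  outputNode_injective : Function.Injective outputNode
  /-- the number of clock cycles -/
  cycles : ℕ
  cycles_pos : 0 < cycles
  /-- states of the nodes -/
  State : Type
  /-- the state in which a node starts, given the input loaded into it, if there is one -/
  init : (v : Node) → ({i : Fin n // inputNode i = v} → Symbol) → State
  /-- the bit that a node in a given state sends into each wire end attached to it -/
  send : (v : Node) → State → {e : Wire × Bool // ends e.1 e.2 = v} → Bool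
  /-- the next state of a node, given its state and the bit it receives from each wire end
  attached to it -/
  next : (v : Node) → State → ({e : Wire × Bool // ends e.1 e.2 = v} → Bool) → State
  /-- the bit read from an output node in a given state -/
  read : Fin k → State → Bool

attribute [instance] Circuit.fintypeNode Circuit.fintypeWire

namespace Circuit

/-- The states of all nodes after `t` clock cycles on the input `y`. The bit received from
the end `b` of a wire is the one sent in the same cycle by the node at its other end. -/
def stateAt {n k : ℕ} (D : Circuit n k) (y : Fin n → Symbol) : ℕ → D.Node → D.State
  | 0, v => D.init v fun i => y i.1
  | t + 1, v => D.next v (D.stateAt y t v) fun e =>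
      D.send (D.ends e.1.1 (!e.1.2)) (D.stateAt y t (D.ends e.1.1 (!e.1.2)))
        ⟨(e.1.1, !e.1.2), rfl⟩

/-- The function computed by the circuit. -/
def compute {n k : ℕ} (D : Circuit n k) (y : Fin n → Symbol) : Fin k → Bool :=
  fun j => D.read j (D.stateAt y D.cycles (D.outputNode j))

/-- The area `A`: the number of squares that hold a node, a wire or a wire crossing. -/
def area {n k : ℕ} (D : Circuit n k) : ℕ :=
  (Finset.univ.image D.pos ∪ Finset.univ.biUnion fun w => (D.route w).support.toFinset).card

/-- The energy `E = A T`. -/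
def energy {n k : ℕ} (D : Circuit n k) : ℕ := D.area * D.cycles

end Circuit

/-- The transition probability `P(y | x)` of the binary erasure channel with erasure
probability `ε`. -/
def erasureProb (ε : ℝ) (x : Bool) : Symbol → ℝ
  | none => ε
  | some b => if b = x then 1 - ε else 0

/-- The block error probability of a decoding function for the codebook given by the encoding
function `enc`: the `k` source bits are independent fair coin flips, the codeword is sent over
`n` uses of the binary erasure channel, and an error is a wrong estimate of the source. -/
noncomputable def blockErrorProb {n k : ℕ} (ε : ℝ) (enc : (Fin k → Bool) → Fin n → Bool)
    (dec : (Fin n → Symbol) → Fin k → Bool) : ℝ :=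
  ∑ x : Fin k → Bool, ∑ y : Fin n → Symbol,
    if dec y ≠ x then (1 / 2 : ℝ) ^ k * ∏ i, erasureProb ε (enc x i) (y i) else 0

/-- A (fully-parallel) decoding scheme: decoder circuits with increasing block lengths,
together with their codebooks. -/
structure DecodingScheme where
  /-- block lengths -/
  blockLength : ℕ → ℕ
  blockLength_strictMono : StrictMono blockLength
  /-- numbers of bits decoded -/
  numBits : ℕ → ℕ
  /-- codebooks, as encoding functions -/
  encode : (i : ℕ) → (Fin (numBits i) → Bool) → Fin (blockLength i) → Bool
  /-- decoders -/
  decoder : (i : ℕ) → Circuit (blockLength i) (numBits i)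

namespace DecodingScheme

/-- The block error probability of the `i`-th decoder over a binary erasure channel. -/
noncomputable def errorProb (S : DecodingScheme) (ε : ℝ) (i : ℕ) : ℝ :=
  blockErrorProb ε (S.encode i) (S.decoder i).compute

/-- `S` is an `f(n)`-decoding scheme for the erasure probability `ε`. -/
def IsSchemeFor (S : DecodingScheme) (ε : ℝ) (f : ℕ → ℝ) : Prop :=
  ∀ᶠ i in atTop, S.errorProb ε i < f (S.blockLength i)

/-- The scheme has asymptotic rate `R`. -/
def HasRate (S : DecodingScheme) (R : ℝ) : Prop :=
  Tendsto (fun i => (S.numBits i : ℝ) / (S.blockLength i : ℝ)) atTop (𝓝 R)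

/-- An exponentially-low-error decoding scheme: an `e ^ (-cn)`-decoding scheme for some
`c > 0`, with asymptotic rate greater than `0`. -/
def IsExponentiallyLowError (S : DecodingScheme) (ε : ℝ) : Prop :=
  (∃ c : ℝ, 0 < c ∧ S.IsSchemeFor ε fun n => Real.exp (-c * n)) ∧ ∃ R : ℝ, 0 < R ∧ S.HasRate R

end DecodingScheme

end Thompson

/-! Both bounds follow from `A T ^ 2 = Ω(n ^ 2)`. Suppose that a set of nodes outputs more bits than
it can receive from outside in `T` cycles. If all of its own inputs are erased, it knows its output
bits only through what it receives, so at least half of the sources are decoded wrongly. This costs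
error probability at least `ε ^ m / 2` when the set holds at most `m` inputs
(`le_blockErrorProb_of_lt`). With `m` a small enough fraction of `n`, an error below `e ^ (-cn)`
rules this out, so every such set receives at least as many bits as it outputs.

The layout is planar, so the nodes split into boundedly many parts with at most `m` inputs each,
joined by only `O(√A)` wires (`exists_partition`). Adding the inequalities over the parts gives `k =
O(√A T)`, and `k` is proportional to `n`.

Since also `A ≥ n`, `(A T) ^ 2 = A * (A T ^ 2)` is at least a constant times `n ^ 3`; the function
`p` is not needed for this. Dividing `A T ^ 2` by an energy `O(n ^ (3 / 2))` bounds `T` from below.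
-/

namespace Thompson

open Finset

/-! ### Information flow into a set of nodes, and the cut-set bound. -/

namespace Circuit

variable {n k : ℕ} (D : Circuit n k)

/-- The bit that arrives in cycle `t` at the wire end `e`. -/
def received (y : Fin n → Symbol) (t : ℕ) (e : D.Wire × Bool) : Bool :=
  D.send (D.ends e.1 (!e.2)) (D.stateAt y t (D.ends e.1 (!e.2))) ⟨(e.1, !e.2), rfl⟩

/-- The wire ends through which the set `P` of nodes receives bits from other nodes. -/
def entries (P : D.Node → Prop) [DecidablePred P] : Finset (D.Wire × Bool) :=
  {e | P (D.ends e.1 e.2) ∧ ¬ P (D.ends e.1 (!e.2))}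

/-- The states inside `P` depend only on the inputs loaded there and on the bits received from
outside. -/
theorem stateAt_congr (P : D.Node → Prop) [DecidablePred P] {y y' : Fin n → Symbol}
    (hin : ∀ i, P (D.inputNode i) → y i = y' i) (T : ℕ)
    (hrec : ∀ t < T, ∀ e ∈ D.entries P, D.received y t e = D.received y' t e) :
    ∀ t ≤ T, ∀ v, P v → D.stateAt y t v = D.stateAt y' t v := by
  intro t
  induction t with
  | zero =>
    intro _ v hv
    simp only [stateAt]
    congr 1
    funext i
    exact hin i.1 (i.2.symm ▸ hv)
  | succ t ih =>
    intro ht v hv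
    simp only [stateAt]
    rw [ih (by omega) v hv]
    congr 1
    funext e
    by_cases ho : P (D.ends e.1.1 (!e.1.2))
    · rw [ih (by omega) _ ho]
    · exact hrec t (by omega) e.1 (by
        simp only [entries, mem_filter, mem_univ, true_and]
        exact ⟨e.2.symm ▸ hv, ho⟩)

end Circuit

/-- The word received when `x` is sent and the positions with `S i = true` are erased. -/
def erase {n : ℕ} (S : Fin n → Bool) (x : Fin n → Bool) : Fin n → Symbol :=
  fun i => if S i then none else some (x i)

theorem erase_injective {n : ℕ} (x : Fin n → Bool) :
    Function.Injective fun S : Fin n → Bool => erase S x := by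
  intro S S' h
  funext i
  have := congrFun h i
  simp only [erase] at this
  cases hS : S i <;> cases hS' : S' i <;> simp_all

theorem erasureProb_nonneg {ε : ℝ} (h0 : 0 ≤ ε) (h1 : ε ≤ 1) (x : Bool) (s : Symbol) :
    0 ≤ erasureProb ε x s := by
  cases s with
  | none => exact h0
  | some b => simp only [erasureProb]; split_ifs <;> linarith

/-- The probability of an erasure pattern. -/
theorem prod_erasureProb_erase {n : ℕ} (ε : ℝ) (S x : Fin n → Bool) :
    ∏ i, erasureProb ε (x i) (erase S x i) = ∏ i, if S i then ε else 1 - ε := by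
  refine prod_congr rfl fun i _ => ?_
  simp only [erase]
  split_ifs <;> simp [erasureProb]

/-- The probability that the positions in `I` are erased. -/
theorem sum_prod_erasure {n : ℕ} (ε : ℝ) (I : Finset (Fin n)) :
    ∑ S ∈ Fintype.piFinset (fun i => if i ∈ I then ({true} : Finset Bool) else univ),
      ∏ i, (if S i then ε else 1 - ε) = ε ^ #I := by
  rw [← prod_univ_sum (t := fun i => if i ∈ I then ({true} : Finset Bool) else univ)
    (f := fun _ b => if b then ε else 1 - ε)]
  have : ∀ i, (∑ b ∈ (if i ∈ I then ({true} : Finset Bool) else univ),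
      if b then ε else 1 - ε) = if i ∈ I then ε else 1 := by
    intro i
    split_ifs <;> simp
  simp only [this, prod_ite_mem, univ_inter, prod_const]

/-- If, for every pattern erasing the positions in `I`, at least half of the sources are decoded
wrongly, then the error probability is at least `ε ^ #I / 2`. -/
theorem le_blockErrorProb {n k : ℕ} {ε : ℝ} (h0 : 0 ≤ ε) (h1 : ε ≤ 1)
    (enc : (Fin k → Bool) → Fin n → Bool) (dec : (Fin n → Symbol) → Fin k → Bool)
    (I : Finset (Fin n))
    (h : ∀ S : Fin n → Bool, (∀ i ∈ I, S i = true) →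
      2 ^ k ≤ 2 * #{x | dec (erase S (enc x)) ≠ x}) :
    ε ^ #I / 2 ≤ blockErrorProb ε enc dec := by
  set F := Fintype.piFinset (fun i => if i ∈ I then ({true} : Finset Bool) else univ) with hF
  have hnn : ∀ x y, 0 ≤ (if dec y ≠ x then
      (1 / 2 : ℝ) ^ k * ∏ i, erasureProb ε (enc x i) (y i) else 0) := by
    intro x y
    split_ifs
    · exact mul_nonneg (by positivity) (prod_nonneg fun i _ => erasureProb_nonneg h0 h1 _ _)
    · exact le_rfl
  have hsub : ∑ x : Fin k → Bool, ∑ S ∈ F, (if dec (erase S (enc x)) ≠ x then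
      (1 / 2 : ℝ) ^ k * ∏ i, (if S i then ε else 1 - ε) else 0) ≤ blockErrorProb ε enc dec := by
    refine sum_le_sum fun x _ => ?_
    simp_rw [← prod_erasureProb_erase ε _ (enc x)]
    -- For a fixed codeword, distinct erasure patterns give distinct received words, so the sum over
    -- patterns is part of the sum over received words.
    rw [← sum_image (s := F) (g := fun S => erase S (enc x))
      (f := fun y => if dec y ≠ x then
        (1 / 2 : ℝ) ^ k * ∏ i, erasureProb ε (enc x i) (y i) else 0)
      (fun _ _ _ _ e => erase_injective _ e)]
    exact sum_le_sum_of_subset_of_nonneg (subset_univ _) fun y _ _ => hnn x y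
  refine le_trans ?_ hsub
  rw [sum_comm, ← sum_prod_erasure ε I, sum_div]
  refine sum_le_sum fun S hS => ?_
  have hSI : ∀ i ∈ I, S i = true := by
    intro i hi
    have := Fintype.mem_piFinset.1 hS i
    simpa [hi] using this
  have hw : 0 ≤ ∏ i, (if S i then ε else 1 - ε) :=
    prod_nonneg fun i _ => by split_ifs <;> linarith
  have hc : (2 : ℝ) ^ k ≤ 2 * #{x | dec (erase S (enc x)) ≠ x} := by exact_mod_cast h S hSI
  rw [← sum_filter, sum_const, nsmul_eq_mul]
  have hhalf : (1 : ℝ) / 2 ≤ #{x | dec (erase S (enc x)) ≠ x} * (1 / 2 : ℝ) ^ k := by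
    rw [one_div_pow, mul_one_div, div_le_div_iff₀ (by norm_num) (by positivity)]
    linarith
  calc _ = 1 / 2 * ∏ i, (if S i then ε else 1 - ε) := by ring
    _ ≤ _ := mul_le_mul_of_nonneg_right hhalf hw
    _ = _ := by ring

namespace Circuit

variable {n k : ℕ} (D : Circuit n k)

/-- When the inputs loaded into `P` are erased, few sources can be decoded correctly. -/
theorem card_correct_le (P : D.Node → Prop) [DecidablePred P]
    (enc : (Fin k → Bool) → Fin n → Bool) (S : Fin n → Bool)
    (hS : ∀ i, P (D.inputNode i) → S i = true) :
    #{x | D.compute (erase S (enc x)) = x} ≤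
      2 ^ (#{j | ¬ P (D.outputNode j)} + #(D.entries P) * D.cycles) := by
  classical
  -- A correctly decoded source is determined by its bits output outside `P` and by the bits that
  -- enter `P`: the erased inputs tell `P` nothing.
  let f : (Fin k → Bool) → ({j // ¬ P (D.outputNode j)} → Bool) ×
      ((D.entries P) × Fin D.cycles → Bool) :=
    fun x => (fun j => x j.1, fun p => D.received (erase S (enc x)) p.2 p.1)
  have hinj : Set.InjOn f {x | D.compute (erase S (enc x)) = x} := by
    intro x hx x' hx' hf
    simp only [f, Prod.mk.injEq] at hf
    have hst := D.stateAt_congr P (y := erase S (enc x)) (y' := erase S (enc x'))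
      (fun i hi => by simp [erase, hS i hi]) D.cycles
      (fun t ht e he => congrFun hf.2 (⟨e, he⟩, ⟨t, ht⟩)) D.cycles le_rfl
    funext j
    by_cases hj : P (D.outputNode j)
    · rw [← congrFun hx j, ← congrFun hx' j]
      simp only [compute, hst _ hj]
    · exact congrFun hf.1 ⟨j, hj⟩
  have hcard := card_le_card_of_injOn (s := {x | D.compute (erase S (enc x)) = x})
    (t := univ) f (by simp) (by simpa using hinj)
  refine hcard.trans (le_of_eq ?_)
  simp [Fintype.card_subtype, pow_add]

/-- The cut-set bound for a set `P` of nodes. -/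
theorem le_blockErrorProb_of_lt {ε : ℝ} (h0 : 0 ≤ ε) (h1 : ε ≤ 1) (P : D.Node → Prop)
    [DecidablePred P] (enc : (Fin k → Bool) → Fin n → Bool)
    (h : #(D.entries P) * D.cycles < #{j | P (D.outputNode j)}) :
    ε ^ #{i | P (D.inputNode i)} / 2 ≤ blockErrorProb ε enc D.compute := by
  refine le_blockErrorProb h0 h1 enc _ _ fun S hS => ?_
  have hle := D.card_correct_le P enc S fun i hi => hS i (by simpa using hi)
  have hk : #{j | P (D.outputNode j)} + #{j | ¬ P (D.outputNode j)} = k := by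
    simpa using card_filter_add_card_filter_not (s := (univ : Finset (Fin k)))
      fun j => P (D.outputNode j)
  have hx : #{x | D.compute (erase S (enc x)) = x} +
      #{x | D.compute (erase S (enc x)) ≠ x} = 2 ^ k := by
    simpa using card_filter_add_card_filter_not (s := (univ : Finset (Fin k → Bool)))
      fun x => D.compute (erase S (enc x)) = x
  -- The strict deficit in `h` makes the exponent at most `k - 1`.
  have hpow : 2 * 2 ^ (#{j | ¬ P (D.outputNode j)} + #(D.entries P) * D.cycles) ≤ 2 ^ k := by
    rw [← pow_succ']
    exact Nat.pow_le_pow_right (by norm_num) (by omega)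
  omega

/-- The wires whose ends have different labels. -/
def cutWires (lab : D.Node → ℕ) : Finset D.Wire :=
  {w | lab (D.ends w false) ≠ lab (D.ends w true)}

/-- If every part of a partition of the nodes receives at least as many bits as it outputs, then
the cut wires carry at least `k` bits. -/
theorem numBits_le_cutWires (lab : D.Node → ℕ)
    (h : ∀ l, #{j | lab (D.outputNode j) = l} ≤ #(D.entries fun v => lab v = l) * D.cycles) :
    k ≤ 2 * #(D.cutWires lab) * D.cycles := by
  classical
  let K : Finset ℕ := univ.image lab
  have h1 : k = ∑ l ∈ K, #{j | lab (D.outputNode j) = l} := by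
    simpa using card_eq_sum_card_fiberwise (s := (univ : Finset (Fin k))) (t := K)
      (f := fun j => lab (D.outputNode j)) (fun j _ => by simp [K])
  -- A wire end is an entry of at most one part, and then its wire is cut. The two ends of a wire
  -- account for the factor 2.
  have h2 : ∑ l ∈ K, #(D.entries fun v => lab v = l) ≤
      #(D.cutWires lab ×ˢ (univ : Finset Bool)) := by
    rw [← card_biUnion]
    · refine card_le_card fun e he => ?_
      obtain ⟨w, b⟩ := e
      simp only [mem_biUnion, entries, mem_filter, mem_univ, true_and] at he
      obtain ⟨l, -, h1, h2⟩ := he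
      simp only [cutWires, mem_product, mem_filter, mem_univ, true_and, and_true]
      cases b <;> (simp_all; try omega)
    · intro l _ l' _ hne
      refine disjoint_left.2 fun e he he' => hne ?_
      simp only [entries, mem_filter, mem_univ, true_and] at he he'
      exact he.1.symm.trans he'.1
  calc k = ∑ l ∈ K, #{j | lab (D.outputNode j) = l} := h1
    _ ≤ ∑ l ∈ K, #(D.entries fun v => lab v = l) * D.cycles := sum_le_sum fun l _ => h l
    _ = (∑ l ∈ K, #(D.entries fun v => lab v = l)) * D.cycles := (sum_mul ..).symm
    _ ≤ _ := by
      refine Nat.mul_le_mul_right _ (h2.trans (le_of_eq ?_))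
      rw [card_product]; simp [mul_comm]

end Circuit

end Thompson

/-! ### Planar geometry: cutting the layout along strips. -/

namespace Thompson

open Finset

/-- The position of a square in the ordering by strips of width `s`, rows, and columns. -/
def stripKey (s r : ℤ) (z : ℤ × ℤ) : ℤ ×ₗ ℤ ×ₗ ℤ :=
  toLex ((z.1 - r) / s, toLex (z.2, z.1))

theorem stripKey_lt_iff {s r : ℤ} {z z' : ℤ × ℤ} :
    stripKey s r z < stripKey s r z' ↔ (z.1 - r) / s < (z'.1 - r) / s ∨
      (z.1 - r) / s = (z'.1 - r) / s ∧ (z.2 < z'.2 ∨ z.2 = z'.2 ∧ z.1 < z'.1) := by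
  simp [stripKey, Prod.Lex.toLex_lt_toLex]

theorem stripKey_injective (s r : ℤ) : Function.Injective (stripKey s r) := by
  intro z z' h
  simp only [stripKey, EmbeddingLike.apply_eq_iff_eq, Prod.mk.injEq] at h
  exact Prod.ext h.2.2 h.2.1

/-- The number of elements of the family `a` whose position precedes `c`, divided by `m`. -/
def rankLabel {α : Type*} [LinearOrder α] {n : ℕ} (a : Fin n → α) (m : ℕ) (c : α) : ℕ :=
  #{i | a i < c} / m

section rankLabel

variable {α : Type*} [LinearOrder α] {n : ℕ} (a : Fin n → α) (m : ℕ)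

theorem rankLabel_mono : Monotone (rankLabel a m) := fun _ _ h =>
  Nat.div_le_div_right (card_le_card fun i hi => by
    simp only [mem_filter, mem_univ, true_and] at hi ⊢
    exact hi.trans_le h)

theorem rankLabel_le (c : α) : rankLabel a m c ≤ n / m :=
  Nat.div_le_div_right ((card_le_univ _).trans_eq (by simp))

/-- Distinct elements have distinct ranks, and a label confines the rank to an interval of length
`m`. -/
theorem card_rankLabel_eq_le (ha : Function.Injective a) (hm : 0 < m) (l : ℕ) :
    #{j | rankLabel a m (a j) = l} ≤ m := by
  have hinj : Function.Injective fun j => #{i | a i < a j} := by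
    have hlt : ∀ j j', a j < a j' → #{i | a i < a j} < #{i | a i < a j'} := by
      intro j j' h
      refine card_lt_card ⟨fun i hi => ?_, fun hsub => ?_⟩
      · simp only [mem_filter, mem_univ, true_and] at hi ⊢
        exact hi.trans h
      · have := hsub (x := j) (by simpa using h)
        simp at this
    intro j j' h
    rcases lt_trichotomy (a j) (a j') with h' | h' | h'
    · exact absurd h (hlt _ _ h').ne
    · exact ha h'
    · exact absurd h (hlt _ _ h').ne'
  have := card_le_card_of_injOn (s := {j | rankLabel a m (a j) = l})
    (t := Ico (l * m) (l * m + m)) (fun j => #{i | a i < a j}) (fun j hj => by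
      have hj : #{i | a i < a j} / m = l := (mem_filter.1 (mem_coe.1 hj)).2
      simp only [coe_Ico, Set.mem_Ico]
      have h1 := Nat.div_add_mod #{i | a i < a j} m
      have h2 := Nat.mod_lt #{i | a i < a j} hm
      rw [hj, mul_comm] at h1
      omega) hinj.injOn
  simpa using this

end rankLabel

/-- The square above (`true`) or to the right (`false`) of a given one. -/
def step (z : ℤ × ℤ) (d : Bool) : ℤ × ℤ := if d then (z.1, z.2 + 1) else (z.1 + 1, z.2)

/-- A side shared by two squares, each named by its lower or left square and a direction. -/
theorem exists_step_of_adj {z z' : ℤ × ℤ} (h : squareGrid.Adj z z') :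
    ∃ d, z' = step z d ∨ z = step z' d := by
  obtain ⟨x, y⟩ := z
  obtain ⟨x', y'⟩ := z'
  have h : |x - x'| + |y - y'| = 1 := h
  simp only [step, Bool.exists_bool, Prod.mk.injEq, if_true, Bool.false_eq_true, if_false]
  rcases abs_cases (x - x') with ⟨h1, _⟩ | ⟨h1, _⟩ <;>
    rcases abs_cases (y - y') with ⟨h2, _⟩ | ⟨h2, _⟩ <;> omega

/-- For a suitable offset, few squares of `Q` are the last ones in their strip. -/
theorem exists_offset (Q : Finset (ℤ × ℤ)) {s : ℕ} (hs : 0 < s) :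
    ∃ r : ℤ, 0 ≤ r ∧ r < s ∧ s * #{z ∈ Q | (z.1 + 1) % (s : ℤ) = r} ≤ #Q := by
  have hs' : (0 : ℤ) < s := by exact_mod_cast hs
  by_contra! hcon
  have h1 : #Q = ∑ r ∈ Ico (0 : ℤ) s, #{z ∈ Q | (z.1 + 1) % (s : ℤ) = r} :=
    card_eq_sum_card_fiberwise fun z _ => by
      simp only [coe_Ico, Set.mem_Ico]
      exact ⟨Int.emod_nonneg _ hs'.ne', Int.emod_lt_of_pos _ hs'⟩
  have h2 : ∑ r ∈ Ico (0 : ℤ) s, #Q <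
      ∑ r ∈ Ico (0 : ℤ) s, s * #{z ∈ Q | (z.1 + 1) % (s : ℤ) = r} :=
    sum_lt_sum_of_nonempty ⟨0, by simpa using hs⟩ fun r hr => by
      rw [mem_Ico] at hr
      exact hcon r hr.1 hr.2
  rw [← mul_sum, ← h1] at h2
  simp at h2

/-- The quotient jumps only when the remainder of `x - r` is `s - 1`. Hence a step to the right
stays in its strip unless it starts in the last column. -/
theorem ediv_succ_eq {x r s : ℤ} (hr : 0 ≤ r) (hrs : r < s) (h : (x + 1) % s ≠ r) :
    (x + 1 - r) / s = (x - r) / s := by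
  have hs : 0 < s := by omega
  have h1 := Int.mul_ediv_add_emod (x - r) s
  have h2 := Int.emod_nonneg (x - r) hs.ne'
  have h3 := Int.emod_lt_of_pos (x - r) hs
  set q := (x - r) / s
  set e := (x - r) % s
  by_cases he : e = s - 1
  · exfalso
    apply h
    have : x + 1 = r + s * (q + 1) := by linarith
    rw [this, Int.add_mul_emod_self_left, Int.emod_eq_of_lt hr hrs]
  · have : x + 1 - r = (e + 1) + s * q := by linarith
    rw [this, Int.add_mul_ediv_left _ _ hs.ne', Int.ediv_eq_zero_of_lt (by omega) (by omega),
      zero_add]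

section cut

variable {f : ℤ ×ₗ ℤ ×ₗ ℤ → ℕ} {M s : ℕ} {r : ℤ} (Q : Finset (ℤ × ℤ))

/-- A threshold in the strip ordering separates at most `s` vertically adjacent pairs. -/
theorem card_vertical_cut_le (hf : Monotone f) (hM : ∀ c, f c ≤ M) (hs : 0 < s) :
    #{z ∈ Q | f (stripKey s r z) ≠ f (stripKey s r (step z true))} ≤ M * s := by
  have hs' : (0 : ℤ) < s := by exact_mod_cast hs
  have hlt : ∀ z, stripKey s r z < stripKey s r (step z true) := fun z => by
    rw [stripKey_lt_iff]; simp [step]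
  -- By monotonicity, `z'` must precede the square above `z`, since its label is still below that
  -- square's. But no square strictly between the two in the ordering lies in the same column of a
  -- strip.
  have key : ∀ z z', f (stripKey s r z') < f (stripKey s r (step z' true)) →
      f (stripKey s r (step z true)) = f (stripKey s r (step z' true)) →
      (z.1 - r) % s = (z'.1 - r) % s → ¬ stripKey s r z < stripKey s r z' := by
    intro z z' hz' heq hmod hkey
    have h1 : stripKey s r z' < stripKey s r (step z true) := by
      by_contra hcon
      exact absurd (hf (not_lt.1 hcon)) (by omega)
    rw [stripKey_lt_iff] at hkey h1
    simp only [step, if_true] at h1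
    have e1 := Int.mul_ediv_add_emod (z.1 - r) s
    have e2 := Int.mul_ediv_add_emod (z'.1 - r) s
    have hq : (z.1 - r) / (s : ℤ) = (z'.1 - r) / s := by omega
    rw [hq] at e1
    omega
  have hmaps : #{z ∈ Q | f (stripKey s r z) ≠ f (stripKey s r (step z true))} ≤
      #(Icc 1 M ×ˢ Ico (0 : ℤ) s) := by
    -- The label above a cut exceeds another label, so it is at least 1 and takes at most `M`
    -- values.
    refine card_le_card_of_injOn
      (fun z => (f (stripKey s r (step z true)), (z.1 - r) % (s : ℤ))) ?_ ?_
    · intro z hz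
      rw [mem_coe, mem_filter] at hz
      have := (hf (hlt z).le).lt_of_ne hz.2
      simp only [coe_product, coe_Icc, coe_Ico, Set.mem_prod, Set.mem_Icc, Set.mem_Ico]
      exact ⟨⟨by omega, hM _⟩, Int.emod_nonneg _ hs'.ne', Int.emod_lt_of_pos _ hs'⟩
    · intro z hz z' hz' he
      rw [mem_coe, mem_filter] at hz hz'
      simp only [Prod.mk.injEq] at he
      have hz := (hf (hlt z).le).lt_of_ne hz.2
      have hz' := (hf (hlt z').le).lt_of_ne hz'.2
      refine stripKey_injective s r (le_antisymm ?_ ?_)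
      · exact not_lt.1 (key z' z hz he.1.symm he.2.symm)
      · exact not_lt.1 (key z z' hz' he.1 he.2)
  simpa using hmaps

/-- A threshold in the strip ordering separates at most one pair of horizontally adjacent squares
within the strips. -/
theorem card_horizontal_cut_le (hf : Monotone f) (hM : ∀ c, f c ≤ M) (hr : 0 ≤ r) (hrs : r < s) :
    #{z ∈ Q | f (stripKey s r z) ≠ f (stripKey s r (step z false))} ≤
      #{z ∈ Q | (z.1 + 1) % (s : ℤ) = r} + M := by
  have hlt : ∀ z : ℤ × ℤ, (z.1 + 1) % (s : ℤ) ≠ r →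
      stripKey s r z < stripKey s r (step z false) := fun z hz => by
    rw [stripKey_lt_iff]; simp [step, ediv_succ_eq hr hrs hz]
  -- Here `z` and its right neighbour are consecutive in the ordering, leaving no room for `z'`
  -- between them.
  have key : ∀ z z' : ℤ × ℤ, (z.1 + 1) % (s : ℤ) ≠ r →
      f (stripKey s r z') < f (stripKey s r (step z' false)) →
      f (stripKey s r (step z false)) = f (stripKey s r (step z' false)) →
      ¬ stripKey s r z < stripKey s r z' := by
    intro z z' hz hz' heq hkey
    have h1 : stripKey s r z' < stripKey s r (step z false) := by
      by_contra hcon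
      exact absurd (hf (not_lt.1 hcon)) (by omega)
    rw [stripKey_lt_iff] at hkey h1
    simp only [step, Bool.false_eq_true, if_false, ediv_succ_eq hr hrs hz] at h1
    omega
  have hin : #{z ∈ Q | (z.1 + 1) % (s : ℤ) ≠ r ∧
      f (stripKey s r z) ≠ f (stripKey s r (step z false))} ≤ #(Icc 1 M) := by
    refine card_le_card_of_injOn (fun z => f (stripKey s r (step z false))) ?_ ?_
    · intro z hz
      rw [mem_coe, mem_filter] at hz
      have := (hf (hlt z hz.2.1).le).lt_of_ne hz.2.2
      simp only [coe_Icc, Set.mem_Icc]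
      exact ⟨by omega, hM _⟩
    · intro z hz z' hz' he
      rw [mem_coe, mem_filter] at hz hz'
      have h := (hf (hlt z hz.2.1).le).lt_of_ne hz.2.2
      have h' := (hf (hlt z' hz'.2.1).le).lt_of_ne hz'.2.2
      refine stripKey_injective s r (le_antisymm ?_ ?_)
      · exact not_lt.1 (key z' z hz'.2.1 h he.symm)
      · exact not_lt.1 (key z z' hz.2.1 h' he)
  calc _ ≤ #({z ∈ Q | (z.1 + 1) % (s : ℤ) = r} ∪ {z ∈ Q | (z.1 + 1) % (s : ℤ) ≠ r ∧
      f (stripKey s r z) ≠ f (stripKey s r (step z false))}) := by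
        refine card_le_card fun z hz => ?_
        simp only [mem_union, mem_filter] at hz ⊢
        tauto
    _ ≤ _ := card_union_le _ _
    _ ≤ _ := by simpa using hin

end cut

namespace Circuit

variable {n k : ℕ} (D : Circuit n k)

/-- The squares that hold a node, a wire or a wire crossing. -/
def occupied : Finset (ℤ × ℤ) :=
  univ.image D.pos ∪ univ.biUnion fun w => (D.route w).support.toFinset

theorem card_occupied : #D.occupied = D.area := rfl

theorem le_area : n ≤ D.area := by
  classical
  calc n = #((univ : Finset (Fin n)).image (D.pos ∘ D.inputNode)) := by
        rw [card_image_of_injective _ (D.pos_injective.comp D.inputNode_injective)]; simp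
    _ ≤ _ := card_le_card fun z hz => by
        simp only [mem_image, mem_univ, true_and, Function.comp_apply] at hz
        obtain ⟨i, rfl⟩ := hz
        exact mem_union_left _ (mem_image_of_mem _ (mem_univ _))

/-- A wire between squares with different labels passes through a side between such squares. -/
theorem exists_cut_side (lab : ℤ × ℤ → ℕ) (w : D.Wire)
    (hw : lab (D.pos (D.ends w false)) ≠ lab (D.pos (D.ends w true))) :
    ∃ z d, z ∈ D.occupied ∧ s(z, step z d) ∈ (D.route w).edges ∧ lab z ≠ lab (step z d) := by
  obtain ⟨a, ha, h1, h2⟩ := (D.route w).exists_boundary_dart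
    {z | lab z = lab (D.pos (D.ends w false))} rfl (fun h => hw h.symm)
  have hocc : ∀ z ∈ (D.route w).support, z ∈ D.occupied := fun z hz =>
    mem_union_right _ (mem_biUnion.2 ⟨w, mem_univ _, List.mem_toFinset.2 hz⟩)
  have hedge : s(a.fst, a.snd) ∈ (D.route w).edges := List.mem_map.2 ⟨a, ha, rfl⟩
  have hne : lab a.fst ≠ lab a.snd := fun h => h2 (h.symm.trans h1)
  obtain ⟨d, hd | hd⟩ := exists_step_of_adj a.adj
  · refine ⟨a.fst, d, hocc _ ((D.route w).dart_fst_mem_support_of_mem_darts ha), ?_, ?_⟩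
    · rwa [← hd]
    · rwa [← hd]
  · refine ⟨a.snd, d, hocc _ ((D.route w).dart_snd_mem_support_of_mem_darts ha), ?_, ?_⟩
    · rwa [← hd, Sym2.eq_swap]
    · rw [← hd]; exact hne.symm

/-- Each cut wire is charged to a side it crosses between different labels; no two wires share a
side, so the charge is injective. -/
theorem card_cutWires_le (lab : ℤ × ℤ → ℕ) :
    #(D.cutWires fun v => lab (D.pos v)) ≤
      #{z ∈ D.occupied | lab z ≠ lab (step z true)} +
        #{z ∈ D.occupied | lab z ≠ lab (step z false)} := by
  classical
  have hex : ∀ w ∈ D.cutWires (fun v => lab (D.pos v)), ∃ p : (ℤ × ℤ) × Bool,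
      p.1 ∈ D.occupied ∧ s(p.1, step p.1 p.2) ∈ (D.route w).edges ∧
        lab p.1 ≠ lab (step p.1 p.2) := fun w hw => by
    simp only [cutWires, mem_filter, mem_univ, true_and] at hw
    obtain ⟨z, d, h⟩ := D.exists_cut_side lab w hw
    exact ⟨(z, d), h⟩
  choose! g hg using hex
  have h1 := card_le_card_of_injOn (s := D.cutWires fun v => lab (D.pos v))
    (t := {z ∈ D.occupied | lab z ≠ lab (step z true)} ×ˢ {true} ∪
      {z ∈ D.occupied | lab z ≠ lab (step z false)} ×ˢ {false}) g (fun w hw => by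
        obtain ⟨h1, -, h3⟩ := hg w hw
        rcases hgw : g w with ⟨z, _ | _⟩ <;> simp_all) (fun w hw w' hw' he => by
        by_contra hne
        exact D.route_disjoint w w' hne (hg w hw).2.1 (he ▸ (hg w' hw').2.1))
  refine h1.trans ((card_union_le _ _).trans_eq ?_)
  simp

/-- The nodes of a circuit can be partitioned into parts with at most `m` input nodes each so that
few wires join different parts. -/
theorem exists_partition (hn : 0 < n) {m : ℕ} (hm : 0 < m) :
    ∃ lab : D.Node → ℕ, (∀ l, #{i | lab (D.inputNode i) = l} ≤ m) ∧
      #(D.cutWires lab) ^ 2 ≤ 9 * (n / m + 1) ^ 2 * D.area := by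
  -- This width balances the two costs: about `s` sides per threshold and `A / s` sides on strip
  -- borders.
  set s := Nat.sqrt D.area with hs
  have hA : 0 < D.area := hn.trans_le D.le_area
  have hs0 : 0 < s := Nat.sqrt_pos.2 hA
  obtain ⟨r, hr, hrs, hoff⟩ := exists_offset D.occupied hs0
  let a : Fin n → ℤ ×ₗ ℤ ×ₗ ℤ := fun i => stripKey s r (D.pos (D.inputNode i))
  have ha : Function.Injective a :=
    (stripKey_injective s r).comp (D.pos_injective.comp D.inputNode_injective)
  refine ⟨fun v => rankLabel a m (stripKey s r (D.pos v)), card_rankLabel_eq_le a m ha hm, ?_⟩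
  have h1 := D.card_cutWires_le fun z => rankLabel a m (stripKey s r z)
  have h2 := card_vertical_cut_le (s := s) (r := r) D.occupied (rankLabel_mono a m)
    (rankLabel_le a m) hs0
  have h3 := card_horizontal_cut_le D.occupied (rankLabel_mono a m) (rankLabel_le a m) hr hrs
  rw [D.card_occupied] at hoff
  set B := #(D.cutWires fun v => rankLabel a m (stripKey s r (D.pos v)))
  set H := #{z ∈ D.occupied | (z.1 + 1) % (s : ℤ) = r}
  set M := n / m
  have hsq : s * s ≤ D.area := Nat.sqrt_le _
  have hlt : D.area < (s + 1) * (s + 1) := Nat.lt_succ_sqrt _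
  -- From `s * H ≤ A ≤ s ^ 2 + 2 * s`.
  have hH : H ≤ s + 2 := by
    by_contra! hcon
    nlinarith
  -- The count is at most `M * s + H + M`, and `1 ≤ s` absorbs the lower-order terms.
  have hB : B ≤ 3 * (M + 1) * s := by nlinarith
  calc B ^ 2 ≤ (3 * (M + 1) * s) ^ 2 := Nat.pow_le_pow_left hB 2
    _ = 9 * (M + 1) ^ 2 * (s * s) := by ring
    _ ≤ _ := Nat.mul_le_mul_left _ hsq

/-- A circuit with small error probability obeys an `A T ^ 2` bound. -/
theorem sq_numBits_le {ε : ℝ} (h0 : 0 ≤ ε) (h1 : ε ≤ 1) (enc : (Fin k → Bool) → Fin n → Bool)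
    (hn : 0 < n) {m : ℕ} (hm : 0 < m) (herr : blockErrorProb ε enc D.compute < ε ^ m / 2) :
    k ^ 2 ≤ 36 * (n / m + 1) ^ 2 * (D.area * D.cycles ^ 2) := by
  obtain ⟨lab, hlab, hcut⟩ := D.exists_partition hn hm
  have hk : k ≤ 2 * #(D.cutWires lab) * D.cycles := by
    refine D.numBits_le_cutWires lab fun l => ?_
    -- A part with a deficit would have error at least `ε ^ m / 2`, as it holds at most `m` inputs
    -- and `ε ≤ 1`.
    by_contra! hcon
    have h2 := D.le_blockErrorProb_of_lt h0 h1 (fun v => lab v = l) enc hcon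
    have h3 := pow_le_pow_of_le_one h0 h1 (hlab l)
    linarith
  calc k ^ 2 ≤ (2 * #(D.cutWires lab) * D.cycles) ^ 2 := Nat.pow_le_pow_left hk 2
    _ = 4 * #(D.cutWires lab) ^ 2 * D.cycles ^ 2 := by ring
    _ ≤ 4 * (9 * (n / m + 1) ^ 2 * D.area) * D.cycles ^ 2 := by gcongr
    _ = _ := by ring

end Circuit

end Thompson

/-! ### Asymptotics in the block length. -/

namespace Thompson

/-- Half of the exponent `c * n` pays for the `n / M` factors of `ε`; the other half pays for the
extra factor `ε` and the division by 2. -/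
theorem exp_neg_mul_le_pow_div_two {ε c : ℝ} (hε : 0 < ε) (hε1 : ε < 1) {M n : ℕ} (hM : 0 < M)
    (hcM : 2 * -Real.log ε ≤ c * M) (hn : 2 * (-Real.log ε + Real.log 2) ≤ c * n) :
    Real.exp (-c * n) ≤ ε ^ (n / M + 1) / 2 := by
  have hlog : Real.log ε < 0 := Real.log_neg hε hε1
  have hM' : (0 : ℝ) < M := by exact_mod_cast hM
  rw [← Real.log_le_log_iff (Real.exp_pos _) (by positivity), Real.log_exp,
    Real.log_div (by positivity) (by norm_num), Real.log_pow]
  push_cast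
  have h1 : ((n / M : ℕ) : ℝ) ≤ n / M := Nat.cast_div_le
  have h2 : ((n / M : ℕ) : ℝ) * -Real.log ε ≤ n / M * -Real.log ε :=
    mul_le_mul_of_nonneg_right h1 (by linarith)
  have h3 : (n : ℝ) / M * -Real.log ε ≤ c * n / 2 := by
    rw [div_mul_eq_mul_div, div_le_div_iff₀ hM' (by norm_num)]
    nlinarith [Nat.cast_nonneg (α := ℝ) n]
  linarith

/-- The decoders of an exponentially-low-error scheme satisfy `A T ^ 2 = Ω(n ^ 2)`. -/
theorem DecodingScheme.IsExponentiallyLowError.exists_area_mul_sq_cycles {ε : ℝ} (hε0 : 0 < ε)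
    (hε1 : ε < 1) {S : DecodingScheme} (hS : S.IsExponentiallyLowError ε) :
    ∃ κ : ℝ, 0 < κ ∧ ∀ᶠ i in atTop,
      κ * (S.blockLength i : ℝ) ^ 2 ≤ (S.decoder i).area * ((S.decoder i).cycles : ℝ) ^ 2 := by
  obtain ⟨⟨c, hc, herr⟩, R, hR, hrate⟩ := hS
  have hlen : Tendsto (fun i => (S.blockLength i : ℝ)) atTop atTop :=
    tendsto_natCast_atTop_atTop.comp S.blockLength_strictMono.tendsto_atTop
  obtain ⟨M, hM⟩ := exists_nat_gt (2 * -Real.log ε / c)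
  have hlog : Real.log ε < 0 := Real.log_neg hε0 hε1
  have hM0 : 0 < M := by
    have : (0 : ℝ) < M := lt_of_le_of_lt (div_nonneg (by linarith) hc.le) hM
    exact_mod_cast this
  -- Eventually `k ≥ (R / 2) * n`, which gives `R ^ 2 / 4`. The rest is the constant of
  -- `sq_numBits_le` with parts of `n / M + 1` inputs, for which the quotient is at most `M`.
  refine ⟨R ^ 2 / (4 * (36 * (M + 1) ^ 2)), by positivity, ?_⟩
  filter_upwards [herr, hrate.eventually (lt_mem_nhds (half_lt_self hR)),
    hlen.eventually_gt_atTop 0,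
    hlen.eventually_ge_atTop (2 * (-Real.log ε + Real.log 2) / c)] with i h1 h2 h3 h4
  have hn : 0 < S.blockLength i := by exact_mod_cast h3
  rw [div_lt_iff₀ hc, mul_comm (M : ℝ)] at hM
  rw [div_le_iff₀ hc, mul_comm _ c] at h4
  rw [lt_div_iff₀ h3] at h2
  have hdiv : S.blockLength i / (S.blockLength i / M + 1) ≤ M :=
    Nat.div_le_of_le_mul ((Nat.lt_mul_div_succ _ hM0).le.trans_eq (mul_comm _ _))
  have hk := (S.decoder i).sq_numBits_le hε0.le hε1.le (S.encode i) hn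
    (Nat.succ_pos (S.blockLength i / M))
    (h1.trans_le (exp_neg_mul_le_pow_div_two hε0 hε1 hM0 hM.le h4))
  replace hk := hk.trans (Nat.mul_le_mul_right _ (Nat.mul_le_mul_left 36
    (Nat.pow_le_pow_left (Nat.add_le_add_right hdiv 1) 2)))
  have hk' : (S.numBits i : ℝ) ^ 2 ≤ 36 * (M + 1) ^ 2 *
      ((S.decoder i).area * ((S.decoder i).cycles : ℝ) ^ 2) := by exact_mod_cast hk
  have hR2 : (R / 2 * S.blockLength i) ^ 2 ≤ (S.numBits i : ℝ) ^ 2 :=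
    pow_le_pow_left₀ (by positivity) h2.le 2
  rw [div_mul_eq_mul_div, div_le_iff₀ (by positivity)]
  linarith

end Thompson

theorem mainTheorem4 (ε : ℝ) (hε0 : 0 < ε) (hε1 : ε < 1)
    (S : Thompson.DecodingScheme) (hS : S.IsExponentiallyLowError ε) :
    (∀ p : ℕ → ℝ, Tendsto p atTop atTop →
      ∃ C : ℝ, 0 < C ∧ ∀ᶠ i in atTop,
        C * ((S.blockLength i : ℝ) ^ (3 / 2 : ℝ) / p (S.blockLength i))
          ≤ ((S.decoder i).energy : ℝ)) ∧
    ((∃ C : ℝ, 0 < C ∧ ∀ᶠ i in atTop,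
        ((S.decoder i).energy : ℝ) ≤ C * (S.blockLength i : ℝ) ^ (3 / 2 : ℝ)) →
      ∃ C : ℝ, 0 < C ∧ ∀ᶠ i in atTop,
        C * (S.blockLength i : ℝ) ^ (1 / 2 : ℝ) ≤ ((S.decoder i).cycles : ℝ)) := by
  obtain ⟨κ, hκ, hAT⟩ := hS.exists_area_mul_sq_cycles hε0 hε1
  have hpos : ∀ᶠ i in atTop, 0 < S.blockLength i :=
    S.blockLength_strictMono.tendsto_atTop.eventually_gt_atTop 0
  have hsq : ∀ x : ℝ, 0 ≤ x → (x ^ (3 / 2 : ℝ)) ^ 2 = x ^ 3 := fun x hx => by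
    rw [← Real.rpow_natCast, ← Real.rpow_mul hx, ← Real.rpow_natCast]
    norm_num
  have hmul : ∀ x : ℝ, 0 < x → x ^ (1 / 2 : ℝ) * x ^ (3 / 2 : ℝ) = x ^ 2 := fun x hx => by
    rw [← Real.rpow_add hx, ← Real.rpow_natCast]
    norm_num
  refine ⟨fun p hp => ⟨√κ, Real.sqrt_pos.2 hκ, ?_⟩, ?_⟩
  · filter_upwards [hAT,
      (hp.comp S.blockLength_strictMono.tendsto_atTop).eventually_ge_atTop 1] with i h1 h2
    have hA : (S.blockLength i : ℝ) ≤ (S.decoder i).area := by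
      exact_mod_cast (S.decoder i).le_area
    simp only [Thompson.Circuit.energy, Nat.cast_mul]
    set x : ℝ := ((S.blockLength i : ℕ) : ℝ)
    set A : ℝ := (((S.decoder i).area : ℕ) : ℝ)
    set T : ℝ := (((S.decoder i).cycles : ℕ) : ℝ)
    have hx : 0 ≤ x := Nat.cast_nonneg _
    have hT : 0 ≤ T := Nat.cast_nonneg _
    -- Only `p ≥ 1` is used, to discard the division.
    calc √κ * (x ^ (3 / 2 : ℝ) / p (S.blockLength i)) ≤ √κ * x ^ (3 / 2 : ℝ) :=
          mul_le_mul_of_nonneg_left (div_le_self (by positivity) h2) (Real.sqrt_nonneg _)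
      _ ≤ A * T := by
        refine le_of_sq_le_sq ?_ (mul_nonneg (hx.trans hA) hT)
        calc (√κ * x ^ (3 / 2 : ℝ)) ^ 2 = x * (κ * x ^ 2) := by
              rw [mul_pow, Real.sq_sqrt hκ.le, hsq x hx]; ring
          _ ≤ A * (A * T ^ 2) := mul_le_mul hA h1 (by positivity) (hx.trans hA)
          _ = (A * T) ^ 2 := by ring
  · rintro ⟨C, hC, hE⟩
    refine ⟨κ / C, by positivity, ?_⟩
    filter_upwards [hAT, hE, hpos] with i h1 h2 h3
    simp only [Thompson.Circuit.energy, Nat.cast_mul] at h2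
    set x : ℝ := ((S.blockLength i : ℕ) : ℝ)
    set A : ℝ := (((S.decoder i).area : ℕ) : ℝ)
    set T : ℝ := (((S.decoder i).cycles : ℕ) : ℝ)
    have hx : 0 < x := Nat.cast_pos.2 h3
    have hT : 0 ≤ T := Nat.cast_nonneg _
    have hx' : 0 < x ^ (3 / 2 : ℝ) := by positivity
    rw [div_mul_eq_mul_div, div_le_iff₀ hC]
    -- Multiplying by `x ^ (3 / 2)` turns the left side into `κ * x ^ 2`, where the bound on `A T ^
    -- 2` applies.
    refine le_of_mul_le_mul_right ?_ hx'
    calc κ * x ^ (1 / 2 : ℝ) * x ^ (3 / 2 : ℝ) = κ * x ^ 2 := by rw [mul_assoc, hmul x hx]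
      _ ≤ A * T * T := by linarith
      _ ≤ C * x ^ (3 / 2 : ℝ) * T := mul_le_mul_of_nonneg_right h2 hT
      _ = T * C * x ^ (3 / 2 : ℝ) := by ring
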